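/- Let $s\ge 1$, $n$ be natural numbers, let $A\in\mathbb R^{s\times s}$, $b,c\in\mathbb R^s$, $h>0$, let $f:\mathbb R\times\mathbb R^n\to\mathbb R^n$ be continuous, and put $F_c(t,y)=\big(f(t+c_1,y_1),\dots,f(t+c_s,y_s)\big)\in\mathbb R^{sn}$ for $y=(y_1,\dots,y_s)\in\mathbb R^{sn}$. The associated $s$-stage Runge–Kutta dynamics is $$x_{k+1}=x_k+h(b\otimes I_n)^\top F_c(t_k,y),\qquad y=\mathbf 1_s\otimes x_k+h(A\otimes I_n)F_c(t_k,y),\qquad (t_k,x_k)\in\mathbb R\times\mathbb R^n;$$ the second equation comprises the stage equations. The dynamics is called well-defined if, for every $(t_k,x_k)=(t,x)\in\mathbb R\times\mathbb R^n$, the stage equations have exactly one solution $y$. Let $\|\cdot\|$ be a norm on $\mathbb R^{sn}$ and let $[\![\cdot;\cdot]\!]$ be a compatible weak pairing, i.e. a map $\mathbb R^{sn}\times\mathbb R^{sn}\to\mathbb R$ that is subadditive and continuous in its first argument and satisfies $[\![\alpha u;w]\!]=[\![u;\alpha w]\!]=\alpha[\![u;w]\!]$ for $\alpha\ge 0$,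 $[\![-u;-w]\!]=[\![u;w]\!]$, $[\![u;u]\!]>0$ for $u\ne0$, $|[\![u;w]\!]|\le[\![u;u]\!]^{1/2}[\![w;w]\!]^{1/2}$ and $[\![u;u]\!]=\|u\|^2$. A system $\dot y=\Phi(t,y)$ on $\mathbb R^{sn}$ is called strongly infinitesimally contracting if there is $\lambda>0$ with $$\sup_{t\in\mathbb R,\;y\ne y'}\frac{[\![\Phi(t,y)-\Phi(t,y');\,y-y']\!]}{\|y-y'\|^2}\le-\lambda .$$ Let $Q\in\mathbb R^{sn\times sn}$ be invertible, and suppose that, for each parameter $x\in\mathbb R^n$, the auxiliary dynamics $$\dot y=Q^{-1}\big(-y+\mathbf 1_s\otimes x+h(A\otimes I_n)F_c(t,y)\big)$$ is strongly infinitesimally contracting. Then the Runge–Kutta dynamics is well-defined, and: 1. There is a unique $G:\mathbb R\times\mathbb R^n\to\mathbb R^{sn}$ such that $-G(t,x)+\mathbf 1_s\otimes x+h(A\otimes I_n)F_c(t,G(t,x))=0$ for all $(t,x)\in\mathbb R\times\mathbb R^n$. 2. If $f(t,x)=0$ and $c=0$, then $G(t,x)=\mathbf 1_s\otimes x$. 3.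 The Runge–Kutta dynamics has a unique explicit form $x_{k+1}=g(t_k,x_k)$ on $\mathbb R\times\mathbb R^n$, and it is given by $g(t,x)=x+h(b\otimes I_n)^\top F_c(t,G(t,x))$. 4. For every $t\in\mathbb R$ the map $\hat F_t:\mathbb R^{sn}\to\mathbb R^{sn}$, $\hat F_t(y)=y-h(A\otimes I_n)F_c(t,y)$, is bijective, and for all $(t,x)$, with $y=\hat F_t^{-1}(\mathbf 1_s\otimes x)$, $$g(t,x)=\frac1s(\mathbf 1_s\otimes I_n)^\top y+h(v\otimes I_n)^\top F_c(t,y),\qquad v:=b-\frac1sA^\top\mathbf 1_s .$$ -/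

import Mathlib

open scoped Kronecker Matrix

noncomputable section

namespace RungeKutta

/-- A weak pairing on `ℝ^ι`: sub-additive and continuous in the first argument, weakly
homogeneous, positive definite, and satisfying the Cauchy-Schwarz inequality. -/
structure IsWeakPairing {ι : Type*} (wp : (ι → ℝ) → (ι → ℝ) → ℝ) : Prop where
  subadd : ∀ x₁ x₂ y, wp (x₁ + x₂) y ≤ wp x₁ y + wp x₂ y
  cont_left : ∀ y, Continuous fun x => wp x y
  smul_left : ∀ (α : ℝ) x y, 0 ≤ α → wp (α • x) y = α * wp x y
  smul_right : ∀ (α : ℝ) x y, 0 ≤ α → wp x (α • y) = α * wp x y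
  neg_neg : ∀ x y, wp (-x) (-y) = wp x y
  pos_def : ∀ x, x ≠ 0 → 0 < wp x x
  cauchy_schwarz : ∀ x y, |wp x y| ≤ √(wp x x) * √(wp y y)

/-- The weak pairing `wp` is compatible with the norm `N`. -/
def IsCompatible {ι : Type*} (N : Seminorm ℝ (ι → ℝ)) (wp : (ι → ℝ) → (ι → ℝ) → ℝ) : Prop :=
  ∀ x, wp x x = N x ^ 2

/-- The smallest one-sided Lipschitz constant of `F : ℝ × ℝ^ι → ℝ^ι` with respect to the second
argument, as an extended real: it is `⊤` if the difference quotients are unbounded above. -/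
def osLip {ι : Type*} (N : Seminorm ℝ (ι → ℝ)) (wp : (ι → ℝ) → (ι → ℝ) → ℝ)
    (F : ℝ → (ι → ℝ) → (ι → ℝ)) : EReal :=
  ⨆ (t : ℝ) (x : ι → ℝ) (y : ι → ℝ) (_ : x ≠ y),
    ((wp (F t x - F t y) (x - y) / N (x - y) ^ 2 : ℝ) : EReal)

/-- The system `ẏ = F (t, y)` is strongly infinitesimally contracting. -/
def StronglyInfContracting {ι : Type*} (N : Seminorm ℝ (ι → ℝ)) (wp : (ι → ℝ) → (ι → ℝ) → ℝ)
    (F : ℝ → (ι → ℝ) → (ι → ℝ)) : Prop :=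
  ∃ lam : ℝ, 0 < lam ∧ osLip N wp F ≤ ((-lam : ℝ) : EReal)

/-! Vectors of `ℝ^{sn}` are functions on `Fin s × Fin n`; the `i`-th block of `y` is
`fun j => y (i, j)`. This is the indexing of Mathlib's Kronecker product of matrices. -/

/-- The Kronecker product `u ⊗ x` of two column vectors. -/
def kronVec {s n : ℕ} (u : Fin s → ℝ) (x : Fin n → ℝ) : Fin s × Fin n → ℝ :=
  fun p => u p.1 * x p.2

/-- The Kronecker product `u ⊗ I_n` of a column vector and the identity matrix, of size `sn × n`. -/
def kronId {s : ℕ} (n : ℕ) (u : Fin s → ℝ) : Matrix (Fin s × Fin n) (Fin n) ℝ :=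
  Matrix.of fun p j => u p.1 * (1 : Matrix (Fin n) (Fin n) ℝ) p.2 j

/-- `F_c (t, y)`, the stack of the vectors `f (t + c_i, y_i)`. -/
def stackedField {s n : ℕ} (f : ℝ → (Fin n → ℝ) → (Fin n → ℝ)) (c : Fin s → ℝ)
    (t : ℝ) (y : Fin s × Fin n → ℝ) : Fin s × Fin n → ℝ :=
  fun p => f (t + c p.1) (fun j => y (p.1, j)) p.2

/-- The stage equations `y = 1_s ⊗ x + h (A ⊗ I_n) F_c (t, y)`. -/
def StageEq {s n : ℕ} (f : ℝ → (Fin n → ℝ) → (Fin n → ℝ)) (h : ℝ)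
    (A : Matrix (Fin s) (Fin s) ℝ) (c : Fin s → ℝ)
    (t : ℝ) (x : Fin n → ℝ) (y : Fin s × Fin n → ℝ) : Prop :=
  y = kronVec 1 x + h • ((A ⊗ₖ (1 : Matrix (Fin n) (Fin n) ℝ)) *ᵥ stackedField f c t y)

/-- One step of the `s`-stage Runge-Kutta dynamics leads from `x` at time `t` to `x'`: the update
equation `x' = x + h (b ⊗ I_n)ᵀ F_c (t, y)` holds for some solution `y` of the stage equations. -/
def IsStep {s n : ℕ} (f : ℝ → (Fin n → ℝ) → (Fin n → ℝ)) (h : ℝ)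
    (A : Matrix (Fin s) (Fin s) ℝ) (b c : Fin s → ℝ) (t : ℝ) (x x' : Fin n → ℝ) : Prop :=
  ∃ y : Fin s × Fin n → ℝ, StageEq f h A c t x y ∧
    x' = x + h • ((kronId n b)ᵀ *ᵥ stackedField f c t y)

/-- The Runge-Kutta dynamics is well-defined: the stage equations are uniquely solvable. -/
def WellDefined {s n : ℕ} (f : ℝ → (Fin n → ℝ) → (Fin n → ℝ)) (h : ℝ)
    (A : Matrix (Fin s) (Fin s) ℝ) (c : Fin s → ℝ) : Prop :=
  ∀ (t : ℝ) (x : Fin n → ℝ), ∃! y : Fin s × Fin n → ℝ, StageEq f h A c t x y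

/-- `x_{k+1} = g (t_k, x_k)` is an explicit form of the Runge-Kutta dynamics. -/
def IsExplicitForm {s n : ℕ} (f : ℝ → (Fin n → ℝ) → (Fin n → ℝ)) (h : ℝ)
    (A : Matrix (Fin s) (Fin s) ℝ) (b c : Fin s → ℝ) (g : ℝ → (Fin n → ℝ) → (Fin n → ℝ)) : Prop :=
  ∀ (t : ℝ) (x x' : Fin n → ℝ), IsStep f h A b c t x x' ↔ x' = g t x

/-- The right-hand side `Q⁻¹ (-y + 1_s ⊗ x + h (A ⊗ I_n) F_c (t, y))` of the auxiliary dynamics. -/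
def auxField {s n : ℕ} (f : ℝ → (Fin n → ℝ) → (Fin n → ℝ)) (h : ℝ)
    (A : Matrix (Fin s) (Fin s) ℝ) (c : Fin s → ℝ)
    (Q : Matrix (Fin s × Fin n) (Fin s × Fin n) ℝ) (x : Fin n → ℝ)
    (t : ℝ) (y : Fin s × Fin n → ℝ) : Fin s × Fin n → ℝ :=
  Q⁻¹ *ᵥ (-y + kronVec 1 x +
    h • ((A ⊗ₖ (1 : Matrix (Fin n) (Fin n) ℝ)) *ᵥ stackedField f c t y))

/-- The map `y ↦ y - h (A ⊗ I_n) F_c (t, y)`. -/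
def stageMap {s n : ℕ} (f : ℝ → (Fin n → ℝ) → (Fin n → ℝ)) (h : ℝ)
    (A : Matrix (Fin s) (Fin s) ℝ) (c : Fin s → ℝ)
    (t : ℝ) (y : Fin s × Fin n → ℝ) : Fin s × Fin n → ℝ :=
  y - h • ((A ⊗ₖ (1 : Matrix (Fin n) (Fin n) ℝ)) *ᵥ stackedField f c t y)

/-- `G` solves the stage equations in residual form at every `(t, x)`. -/
def IsStageSolution {s n : ℕ} (f : ℝ → (Fin n → ℝ) → (Fin n → ℝ)) (h : ℝ)
    (A : Matrix (Fin s) (Fin s) ℝ) (c : Fin s → ℝ)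
    (G : ℝ → (Fin n → ℝ) → (Fin s × Fin n → ℝ)) : Prop :=
  ∀ (t : ℝ) (x : Fin n → ℝ), -G t x + kronVec 1 x +
    h • ((A ⊗ₖ (1 : Matrix (Fin n) (Fin n) ℝ)) *ᵥ stackedField f c t (G t x)) = 0

/-- The vector `v = b - (1/s) Aᵀ 1_s`. -/
def vVec {s : ℕ} (A : Matrix (Fin s) (Fin s) ℝ) (b : Fin s → ℝ) : Fin s → ℝ :=
  b - (1 / (s : ℝ)) • (Aᵀ *ᵥ 1)

end RungeKutta

end

/-!
The heart of the matter is that a continuous field `Φ` on `ℝ^ι` with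
`⟦Φ x - Φ y; x - y⟧ ≤ -λ ‖x - y‖²`, `λ > 0`, is a bijection of `ℝ^ι` onto itself. Up to sign and the
factor `Q⁻¹`, the auxiliary field differs from the stage map `y ↦ y - h (A ⊗ I_n) F_c (t, y)` only
by an additive constant, so the stage map is bijective, and everything else is algebra.

By the Cauchy-Schwarz inequality such a field is expansive: `λ ‖x - y‖ ≤ ‖Φ x - Φ y‖`. This gives
injectivity. For surjectivity, neither the flow of `Φ` nor the invariance of domain is used.
Instead, `Φ` is mollified. Since `⟦·; w⟧` is convex and continuous, the sublevel set
`{u | ⟦u; w⟧ ≤ r}` is closed and convex, hence stable under averaging, so each mollification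
`Φ_k` satisfies the one-sided Lipschitz inequality with the same constant `λ`
(`wp_convolution_sub_le`). A `C¹` expansive map has invertible derivatives, so it is open by the
inverse function theorem; its range is also closed, so it is onto (`surjective_of_contDiff`).
The solutions of `Φ_k x_k = z` are bounded because `λ` does not depend on `k`, and any of their
accumulation points solves `Φ x = z` (`surjective_of_dissipative`).
-/

open Filter Topology MeasureTheory Set

/-! ### Smooth expansive maps -/

section Expansive

variable {E : Type*} [NormedAddCommGroup E] [NormedSpace ℝ E]

/-- A lower bound on the expansion of a map passes to its derivative. -/
theorem HasFDerivAt.mul_norm_le_of_expansive {K : ℝ} {F : E → E} {F' : E →L[ℝ] E} {x : E}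
    (hF' : HasFDerivAt F F' x) (hF : ∀ x y, K * ‖x - y‖ ≤ ‖F x - F y‖) (v : E) :
    K * ‖v‖ ≤ ‖F' v‖ := by
  have hlim := (hF'.hasLineDerivAt v).tendsto_slope_zero_right.norm
  refine ge_of_tendsto hlim ?_
  filter_upwards [self_mem_nhdsWithin] with t ht
  have ht : 0 < t := ht
  have h1 := hF (x + t • v) x
  rw [add_sub_cancel_left, norm_smul, Real.norm_of_nonneg ht.le] at h1
  rw [norm_smul, norm_inv, Real.norm_of_nonneg ht.le, inv_mul_eq_div, le_div_iff₀ ht]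
  linarith

/-- A `C¹` self-map of a finite-dimensional space that expands distances by a positive factor is
onto: its range is open by the inverse function theorem, and closed. -/
theorem surjective_of_contDiff [FiniteDimensional ℝ E] {K : ℝ} (hK : 0 < K) {F : E → E}
    (hsm : ContDiff ℝ 1 F) (hF : ∀ x y, K * ‖x - y‖ ≤ ‖F x - F y‖) : Function.Surjective F := by
  have := FiniteDimensional.complete ℝ E
  have hopen : IsOpen (range F) := by
    refine isOpen_iff_mem_nhds.2 ?_
    rintro _ ⟨x, rfl⟩
    have hx : HasStrictFDerivAt F (fderiv ℝ F x) x :=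
      hsm.contDiffAt.hasStrictFDerivAt one_ne_zero
    have hinj : Function.Injective (fderiv ℝ F x : E →ₗ[ℝ] E) := by
      refine (injective_iff_map_eq_zero _).2 fun v hv => ?_
      have h1 := hx.hasFDerivAt.mul_norm_le_of_expansive hF v
      rw [show fderiv ℝ F x v = 0 from hv, norm_zero] at h1
      exact norm_le_zero_iff.1 (nonpos_of_mul_nonpos_right h1 hK)
    rw [← hx.map_nhds_eq_of_surj
      (LinearMap.range_eq_top.2 (LinearMap.injective_iff_surjective.1 hinj))]
    exact range_mem_map
  have hclosed : IsClosed (range F) := by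
    refine isClosed_of_closure_subset fun z hz => ?_
    obtain ⟨u, hu, huz⟩ := mem_closure_iff_seq_limit.1 hz
    choose x hx using hu
    have hcau : CauchySeq x := by
      refine Metric.cauchySeq_iff.2 fun ε hε => ?_
      obtain ⟨M, hM⟩ := Metric.cauchySeq_iff.1 huz.cauchySeq (K * ε) (mul_pos hK hε)
      refine ⟨M, fun m hm k hk => ?_⟩
      have h1 := hM m hm k hk
      rw [← hx, ← hx, dist_eq_norm] at h1
      rw [dist_eq_norm]
      exact lt_of_mul_lt_mul_left ((hF _ _).trans_lt h1) hK.le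
    obtain ⟨a, ha⟩ := cauchySeq_tendsto_of_complete hcau
    refine ⟨a, tendsto_nhds_unique ((hsm.continuous.tendsto a).comp ha) ?_⟩
    simpa only [Function.comp_def, hx] using huz
  exact range_eq_univ.1 (IsClopen.eq_univ ⟨hclosed, hopen⟩ (range_nonempty F))

end Expansive

/-! ### Weak pairings -/

namespace RungeKutta

section WeakPairing

variable {ι : Type*} {wp : (ι → ℝ) → (ι → ℝ) → ℝ}

theorem IsWeakPairing.zero_left (hwp : IsWeakPairing wp) (y : ι → ℝ) : wp 0 y = 0 := by
  simpa using hwp.smul_left 0 0 y le_rfl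

theorem IsWeakPairing.convex_sublevel (hwp : IsWeakPairing wp) (w : ι → ℝ) (r : ℝ) :
    Convex ℝ {u | wp u w ≤ r} := by
  intro u hu v hv a b ha hb hab
  have hu : wp u w ≤ r := hu
  have hv : wp v w ≤ r := hv
  calc wp (a • u + b • v) w ≤ wp (a • u) w + wp (b • v) w := hwp.subadd _ _ _
    _ = a * wp u w + b * wp v w := by rw [hwp.smul_left _ _ _ ha, hwp.smul_left _ _ _ hb]
    _ ≤ a * r + b * r := by gcongr
    _ = r := by rw [← add_mul, hab, one_mul]

theorem IsWeakPairing.abs_le (hwp : IsWeakPairing wp) {N : Seminorm ℝ (ι → ℝ)}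
    (hNwp : IsCompatible N wp) (u w : ι → ℝ) : |wp u w| ≤ N u * N w := by
  have h1 := hwp.cauchy_schwarz u w
  rwa [hNwp, hNwp, Real.sqrt_sq (apply_nonneg N u), Real.sqrt_sq (apply_nonneg N w)] at h1

/-- A field with negative one-sided Lipschitz constant `-lam` expands distances by the factor
`lam`. -/
theorem mul_le_of_dissipative (hwp : IsWeakPairing wp) {N : Seminorm ℝ (ι → ℝ)}
    (hNwp : IsCompatible N wp) {lam : ℝ} {F : (ι → ℝ) → ι → ℝ}
    (hF : ∀ x y, wp (F x - F y) (x - y) ≤ -lam * N (x - y) ^ 2) (x y : ι → ℝ) :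
    lam * N (x - y) ≤ N (F x - F y) := by
  rcases (apply_nonneg N (x - y)).eq_or_lt with h0 | h0
  · rw [← h0, mul_zero]
    exact apply_nonneg _ _
  · have h1 := (abs_le.1 (hwp.abs_le hNwp (F x - F y) (x - y))).1
    refine le_of_mul_le_mul_right ?_ h0
    nlinarith [hF x y]

theorem injective_of_dissipative (hN : ∀ y, N y = 0 → y = 0) (hwp : IsWeakPairing wp)
    (hNwp : IsCompatible N wp) {lam : ℝ} (hlam : 0 < lam) {F : (ι → ℝ) → ι → ℝ}
    (hF : ∀ x y, wp (F x - F y) (x - y) ≤ -lam * N (x - y) ^ 2) : Function.Injective F := by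
  intro x y hxy
  have h1 := mul_le_of_dissipative hwp hNwp hF x y
  rw [hxy, sub_self, map_zero] at h1
  exact sub_eq_zero.1
    (hN _ (le_antisymm (nonpos_of_mul_nonpos_right h1 hlam) (apply_nonneg N _)))

/-- The one-sided Lipschitz inequality, freed of extended reals and of division. -/
theorem StronglyInfContracting.exists_dissipative {N : Seminorm ℝ (ι → ℝ)}
    (hN : ∀ y, N y = 0 → y = 0) (hwp : IsWeakPairing wp) {F : ℝ → (ι → ℝ) → ι → ℝ}
    (hF : StronglyInfContracting N wp F) :
    ∃ lam : ℝ, 0 < lam ∧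
      ∀ t x y, wp (F t x - F t y) (x - y) ≤ -lam * N (x - y) ^ 2 := by
  obtain ⟨lam, hlam, hle⟩ := hF
  refine ⟨lam, hlam, fun t x y => ?_⟩
  rcases eq_or_ne x y with rfl | hxy
  · simp [hwp.zero_left]
  · simp only [osLip, iSup_le_iff] at hle
    have hpos : 0 < N (x - y) :=
      (apply_nonneg N _).lt_of_ne fun h => hxy (sub_eq_zero.1 (hN _ h.symm))
    exact (div_le_iff₀ (by positivity)).1 (EReal.coe_le_coe_iff.1 (hle t x y hxy))

end WeakPairing

/-! ### Mollification and surjectivity -/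

section Dissipative

variable {ι : Type*} [Fintype ι] {wp : (ι → ℝ) → (ι → ℝ) → ℝ} {N : Seminorm ℝ (ι → ℝ)}

/-- A definite seminorm on `ℝ^ι` is equivalent to the sup norm. -/
theorem exists_norm_equiv (hN : ∀ y, N y = 0 → y = 0) :
    ∃ m M : ℝ, 0 < m ∧ 0 < M ∧ ∀ y, m * ‖y‖ ≤ N y ∧ N y ≤ M * ‖y‖ := by
  have hcont : Continuous N := continuousOn_univ.1 (N.convexOn.continuousOn isOpen_univ)
  obtain ⟨M, hM, hMle⟩ := Seminorm.bound_of_continuous_normedSpace N hcont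
  rcases subsingleton_or_nontrivial (ι → ℝ) with hE | hE
  · refine ⟨1, M, one_pos, hM, fun y => ⟨?_, hMle y⟩⟩
    simp [Subsingleton.elim y 0]
  obtain ⟨u, hu, hmin⟩ := (isCompact_sphere (0 : ι → ℝ) 1).exists_isMinOn
    (NormedSpace.sphere_nonempty.2 zero_le_one) hcont.continuousOn
  have hu0 : u ≠ 0 := ne_zero_of_mem_unit_sphere (⟨u, hu⟩ : Metric.sphere (0 : ι → ℝ) 1)
  refine ⟨N u, M, (apply_nonneg N u).lt_of_ne fun h => hu0 (hN _ h.symm), hM,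
    fun y => ⟨?_, hMle y⟩⟩
  rcases eq_or_ne y 0 with rfl | hy
  · simp
  have hy' : 0 < ‖y‖ := norm_pos_iff.2 hy
  have h1 : N u ≤ N (‖y‖⁻¹ • y) :=
    isMinOn_iff.1 hmin _ (by simp [norm_smul, hy'.ne'])
  rw [map_smul_eq_mul, norm_inv, norm_norm, inv_mul_eq_div, le_div_iff₀ hy'] at h1
  exact h1

/-- Mollification preserves the one-sided Lipschitz inequality: the difference of two values of the
mollified field is an average of vectors in a closed convex sublevel set of `wp · (x - y)`. -/
theorem wp_convolution_sub_le (hwp : IsWeakPairing wp) {lam : ℝ} {F : (ι → ℝ) → ι → ℝ}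
    (hFc : Continuous F) (hF : ∀ x y, wp (F x - F y) (x - y) ≤ -lam * N (x - y) ^ 2)
    (φ : ContDiffBump (0 : ι → ℝ)) (x y : ι → ℝ) :
    wp (convolution (φ.normed volume) F (ContinuousLinearMap.lsmul ℝ ℝ) volume x -
        convolution (φ.normed volume) F (ContinuousLinearMap.lsmul ℝ ℝ) volume y) (x - y) ≤
      -lam * N (x - y) ^ 2 := by
  set ρ := φ.normed (volume : Measure (ι → ℝ)) with hρ
  have hρc : Continuous ρ := φ.continuous_normed
  have hρs : HasCompactSupport ρ := φ.hasCompactSupport_normed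
  have hρ0 : ∀ t, 0 ≤ ρ t := φ.nonneg_normed
  have hρi : Integrable ρ := hρc.integrable_of_hasCompactSupport hρs
  have hmeas : Measurable fun t => ENNReal.ofReal (ρ t) := hρc.measurable.ennreal_ofReal
  have hfin : ∀ᵐ t ∂(volume : Measure (ι → ℝ)), ENNReal.ofReal (ρ t) < ⊤ := by simp
  set μ := (volume : Measure (ι → ℝ)).withDensity fun t => ENNReal.ofReal (ρ t) with hμ
  have hprob : IsProbabilityMeasure μ := by
    constructor
    rw [hμ, withDensity_apply _ MeasurableSet.univ, Measure.restrict_univ,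
      ← ofReal_integral_eq_lintegral_ofReal hρi (Eventually.of_forall hρ0), hρ,
      φ.integral_normed, ENNReal.ofReal_one]
  have hint : ∀ z, Integrable fun t => ρ t • F (z - t) := fun z =>
    (hρc.smul (hFc.comp (continuous_const.sub continuous_id))).integrable_of_hasCompactSupport
      hρs.smul_right
  have hdiff : ∀ t, ρ t • F (x - t) - ρ t • F (y - t) =
      (ENNReal.ofReal (ρ t)).toReal • (F (x - t) - F (y - t)) := fun t => by
    rw [ENNReal.toReal_ofReal (hρ0 t), smul_sub]
  have hconv : convolution ρ F (ContinuousLinearMap.lsmul ℝ ℝ) volume x -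
      convolution ρ F (ContinuousLinearMap.lsmul ℝ ℝ) volume y =
        ∫ t, (F (x - t) - F (y - t)) ∂μ := by
    rw [hμ, integral_withDensity_eq_integral_toReal_smul hmeas hfin]
    simp only [convolution_def, ContinuousLinearMap.lsmul_apply]
    rw [← integral_sub (hint x) (hint y)]
    simp only [hdiff]
  have hintμ : Integrable (fun t => F (x - t) - F (y - t)) μ := by
    rw [hμ, integrable_withDensity_iff_integrable_smul' hmeas hfin]
    exact ((hint x).sub (hint y)).congr (Eventually.of_forall hdiff)
  rw [hconv]
  refine (hwp.convex_sublevel (x - y) (-lam * N (x - y) ^ 2)).integral_mem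
    (isClosed_le (hwp.cont_left _) continuous_const) (Eventually.of_forall fun t => ?_) hintμ
  simpa using hF (x - t) (y - t)

/-- A continuous field on `ℝ^ι` with negative one-sided Lipschitz constant is onto. -/
theorem surjective_of_dissipative (hN : ∀ y, N y = 0 → y = 0) (hwp : IsWeakPairing wp)
    (hNwp : IsCompatible N wp) {lam : ℝ} (hlam : 0 < lam) {F : (ι → ℝ) → ι → ℝ}
    (hFc : Continuous F) (hF : ∀ x y, wp (F x - F y) (x - y) ≤ -lam * N (x - y) ^ 2) :
    Function.Surjective F := by
  intro z
  obtain ⟨m, M, hm, hM, hmM⟩ := exists_norm_equiv hN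
  have hK : 0 < lam * m / M := by positivity
  let φ : ℕ → ContDiffBump (0 : ι → ℝ) := fun k =>
    ⟨1 / (k + 1) / 2, 1 / (k + 1), by positivity, half_lt_self (by positivity)⟩
  have hφ : Tendsto (fun k => (φ k).rOut) atTop (𝓝 0) := tendsto_one_div_add_atTop_nhds_zero_nat
  let Fs : ℕ → (ι → ℝ) → ι → ℝ := fun k =>
    convolution ((φ k).normed volume) F (ContinuousLinearMap.lsmul ℝ ℝ) volume
  have hexp : ∀ k x y, lam * m / M * ‖x - y‖ ≤ ‖Fs k x - Fs k y‖ := fun k x y => by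
    have h1 := mul_le_of_dissipative hwp hNwp (wp_convolution_sub_le hwp hFc hF (φ k)) x y
    rw [div_mul_eq_mul_div, div_le_iff₀ hM, mul_assoc, mul_comm _ M]
    exact (mul_le_mul_of_nonneg_left (hmM _).1 hlam.le).trans (h1.trans (hmM _).2)
  have hsm : ∀ k, ContDiff ℝ 1 (Fs k) := fun k =>
    (φ k).hasCompactSupport_normed.contDiff_convolution_left _ (φ k).contDiff_normed
      hFc.locallyIntegrable
  choose x hx using fun k => surjective_of_contDiff hK (hsm k) (hexp k) z
  -- The solutions `x k` stay bounded, because `Fs k 0` converges.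
  have hzero : Tendsto (fun k => Fs k 0) atTop (𝓝 (F 0)) :=
    ContDiffBump.convolution_tendsto_right_of_continuous hφ hFc 0
  obtain ⟨R, hR⟩ := ((tendsto_const_nhds (x := z)).sub hzero).norm.bddAbove_range
  have hball : ∀ k, x k ∈ Metric.closedBall (0 : ι → ℝ) (R / (lam * m / M)) := fun k => by
    have h1 := hexp k (x k) 0
    rw [hx, sub_zero] at h1
    rw [mem_closedBall_zero_iff, le_div_iff₀' hK]
    exact h1.trans (hR ⟨k, rfl⟩)
  obtain ⟨a, -, θ, hθ, ha⟩ := (isCompact_closedBall _ _).tendsto_subseq hball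
  refine ⟨a, tendsto_nhds_unique (f := fun k => Fs (θ k) (x (θ k))) (l := atTop) ?_ ?_⟩
  · exact ContDiffBump.convolution_tendsto_right (g := fun _ => F) (hφ.comp hθ.tendsto_atTop)
      (Eventually.of_forall fun _ => hFc.aestronglyMeasurable)
      ((hFc.tendsto a).comp tendsto_snd) ha
  · simp only [hx]
    exact tendsto_const_nhds

end Dissipative

/-! ### Runge-Kutta stage equations -/

section Stages

variable {s n : ℕ} {f : ℝ → (Fin n → ℝ) → (Fin n → ℝ)} {h : ℝ} {A : Matrix (Fin s) (Fin s) ℝ}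
  {c : Fin s → ℝ}

theorem continuous_stackedField (hf : Continuous (Function.uncurry f)) (t : ℝ) :
    Continuous (stackedField f c t) :=
  continuous_pi fun p => (continuous_apply p.2).comp <|
    hf.comp <| continuous_const.prodMk (continuous_pi fun j => continuous_apply (p.1, j))

theorem continuous_auxField (hf : Continuous (Function.uncurry f))
    (Q : Matrix (Fin s × Fin n) (Fin s × Fin n) ℝ) (x : Fin n → ℝ) (t : ℝ) :
    Continuous (auxField f h A c Q x t) :=
  continuous_const.matrix_mulVec <| (continuous_neg.add continuous_const).add <|
    (continuous_const.matrix_mulVec (continuous_stackedField hf t)).const_smul h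

theorem stageEq_iff {t : ℝ} {x : Fin n → ℝ} {y : Fin s × Fin n → ℝ} :
    StageEq f h A c t x y ↔ stageMap f h A c t y = kronVec 1 x :=
  sub_eq_iff_eq_add.symm

theorem isStageSolution_iff {G : ℝ → (Fin n → ℝ) → (Fin s × Fin n → ℝ)} :
    IsStageSolution f h A c G ↔ ∀ t x, StageEq f h A c t x (G t x) :=
  forall₂_congr fun t x => by
    rw [StageEq, add_assoc, neg_add_eq_zero]

theorem auxField_zero (Q : Matrix (Fin s × Fin n) (Fin s × Fin n) ℝ) (t : ℝ)
    (y : Fin s × Fin n → ℝ) : auxField f h A c Q 0 t y = Q⁻¹ *ᵥ -stageMap f h A c t y := by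
  have h0 : kronVec (1 : Fin s → ℝ) (0 : Fin n → ℝ) = 0 := by
    ext p
    simp [kronVec]
  rw [auxField, stageMap, h0, add_zero, neg_sub, neg_add_eq_sub]

/-- The auxiliary field with parameter `0` is minus the stage map, up to the factor `Q⁻¹`; hence
contraction makes the stage map bijective. -/
theorem bijective_stageMap (hf : Continuous (Function.uncurry f))
    {Q : Matrix (Fin s × Fin n) (Fin s × Fin n) ℝ} (hQ : IsUnit Q)
    {N : Seminorm ℝ (Fin s × Fin n → ℝ)} (hN : ∀ y, N y = 0 → y = 0)
    {wp : (Fin s × Fin n → ℝ) → (Fin s × Fin n → ℝ) → ℝ} (hwp : IsWeakPairing wp)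
    (hNwp : IsCompatible N wp)
    (hcontr : StronglyInfContracting N wp (auxField f h A c Q 0)) (t : ℝ) :
    Function.Bijective (stageMap f h A c t) := by
  obtain ⟨lam, hlam, hF⟩ := hcontr.exists_dissipative hN hwp
  have hdet := (Matrix.isUnit_iff_isUnit_det Q).1 hQ
  refine ⟨fun y y' hy => ?_, fun z => ?_⟩
  · refine injective_of_dissipative hN hwp hNwp hlam (hF t) ?_
    rw [auxField_zero, auxField_zero, hy]
  · obtain ⟨y, hy⟩ := surjective_of_dissipative hN hwp hNwp hlam (continuous_auxField hf Q 0 t)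
      (hF t) (Q⁻¹ *ᵥ -z)
    refine ⟨y, neg_injective ?_⟩
    rw [auxField_zero] at hy
    have h1 := congrArg (Q *ᵥ ·) hy
    simpa [Matrix.mulVec_mulVec, Matrix.mul_nonsing_inv Q hdet, Matrix.mulVec_neg] using h1

theorem kronId_transpose_mulVec (u : Fin s → ℝ) (y : Fin s × Fin n → ℝ) (j : Fin n) :
    ((kronId n u)ᵀ *ᵥ y) j = ∑ i, u i * y (i, j) := by
  simp [Matrix.mulVec, dotProduct, kronId, Fintype.sum_prod_type, Matrix.one_apply]

theorem kronecker_one_mulVec (y : Fin s × Fin n → ℝ) (i : Fin s) (j : Fin n) :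
    ((A ⊗ₖ (1 : Matrix (Fin n) (Fin n) ℝ)) *ᵥ y) (i, j) = ∑ k, A i k * y (k, j) := by
  simp [Matrix.mulVec, dotProduct, Fintype.sum_prod_type, Matrix.one_apply]

/-- The update written through the mean of the stages instead of `x`: averaging the stage equations
recovers `x` up to the term `(h / s) (Aᵀ 1_s ⊗ I_n)ᵀ F_c (t, y)`, which `v` compensates. -/
theorem update_eq_mean_add (hs : s ≠ 0) (b : Fin s → ℝ) {t : ℝ} {x : Fin n → ℝ}
    {y : Fin s × Fin n → ℝ} (hy : StageEq f h A c t x y) :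
    x + h • ((kronId n b)ᵀ *ᵥ stackedField f c t y) =
      (1 / (s : ℝ)) • ((kronId n (1 : Fin s → ℝ))ᵀ *ᵥ y) +
        h • ((kronId n (vVec A b))ᵀ *ᵥ stackedField f c t y) := by
  have hs' : (s : ℝ) ≠ 0 := Nat.cast_ne_zero.2 hs
  ext j
  have hsum : ∑ i, y (i, j) =
      s * x j + h * ∑ k, (∑ i, A i k) * stackedField f c t y (k, j) := by
    have h1 : ∀ i, y (i, j) = x j + h * ∑ k, A i k * stackedField f c t y (k, j) := fun i => by
      have h2 := congrFun hy (i, j)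
      rw [Pi.add_apply, Pi.smul_apply, kronecker_one_mulVec] at h2
      simpa [kronVec] using h2
    simp_rw [Finset.sum_mul]
    rw [Finset.sum_congr rfl fun i _ => h1 i, Finset.sum_add_distrib, ← Finset.mul_sum,
      Finset.sum_comm]
    simp
  have hv : ∀ k, vVec A b k = b k - 1 / (s : ℝ) * ∑ i, A i k := fun k => by
    simp [vVec, Matrix.mulVec, dotProduct]
  simp only [Pi.add_apply, Pi.smul_apply, kronId_transpose_mulVec, smul_eq_mul, Pi.one_apply,
    one_mul, hsum, hv, sub_mul, Finset.sum_sub_distrib, mul_assoc, ← Finset.mul_sum]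
  field_simp
  ring

/-- If `c = 0`, every stage evaluates `f` at the time `t`, so the stages may all sit at a zero
of `f t`. -/
theorem stageEq_kronVec_of_eq_zero {t : ℝ} {x : Fin n → ℝ} (hfx : f t x = 0) (hc : c = 0) :
    StageEq f h A c t x (kronVec 1 x) := by
  have h0 : stackedField f c t (kronVec 1 x) = 0 := by
    ext p
    simp [stackedField, kronVec, hc, hfx]
  rw [StageEq, h0, Matrix.mulVec_zero, smul_zero, add_zero]

end Stages

end RungeKutta

theorem theorem2 {s n : ℕ} (hs : 1 ≤ s)
    (f : ℝ → (Fin n → ℝ) → (Fin n → ℝ)) (hf : Continuous (Function.uncurry f))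
    (h : ℝ) (hh : 0 < h)
    (A : Matrix (Fin s) (Fin s) ℝ) (b c : Fin s → ℝ)
    (Q : Matrix (Fin s × Fin n) (Fin s × Fin n) ℝ) (hQ : IsUnit Q)
    (N : Seminorm ℝ (Fin s × Fin n → ℝ)) (hN : ∀ y, N y = 0 → y = 0)
    (wp : (Fin s × Fin n → ℝ) → (Fin s × Fin n → ℝ) → ℝ)
    (hwp : RungeKutta.IsWeakPairing wp) (hNwp : RungeKutta.IsCompatible N wp)
    (hcontr : ∀ x : Fin n → ℝ,
      RungeKutta.StronglyInfContracting N wp (RungeKutta.auxField f h A c Q x)) :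
    RungeKutta.WellDefined (n := n) f h A c ∧
    (∃! G : ℝ → (Fin n → ℝ) → (Fin s × Fin n → ℝ), RungeKutta.IsStageSolution f h A c G) ∧
    ∀ G : ℝ → (Fin n → ℝ) → (Fin s × Fin n → ℝ), RungeKutta.IsStageSolution f h A c G →
      (∀ (t : ℝ) (x : Fin n → ℝ), f t x = 0 → c = 0 → G t x = RungeKutta.kronVec 1 x) ∧
      ∃ g : ℝ → (Fin n → ℝ) → (Fin n → ℝ),
        RungeKutta.IsExplicitForm f h A b c g ∧
        (∀ g' : ℝ → (Fin n → ℝ) → (Fin n → ℝ),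
          RungeKutta.IsExplicitForm f h A b c g' → g' = g) ∧
        (∀ (t : ℝ) (x : Fin n → ℝ),
          g t x = x + h • ((RungeKutta.kronId n b)ᵀ *ᵥ RungeKutta.stackedField f c t (G t x))) ∧
        ∃ hbij : ∀ t : ℝ, Function.Bijective (RungeKutta.stageMap (n := n) f h A c t),
          ∀ (t : ℝ) (x : Fin n → ℝ) (y : Fin s × Fin n → ℝ),
            y = (Equiv.ofBijective _ (hbij t)).symm (RungeKutta.kronVec 1 x) →
            g t x = (1 / (s : ℝ)) • ((RungeKutta.kronId n (1 : Fin s → ℝ))ᵀ *ᵥ y) +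
              h • ((RungeKutta.kronId n (RungeKutta.vVec A b))ᵀ *ᵥ
                RungeKutta.stackedField f c t y) := by
  have hbij : ∀ t, Function.Bijective (RungeKutta.stageMap (n := n) f h A c t) :=
    RungeKutta.bijective_stageMap hf hQ hN hwp hNwp (hcontr 0)
  have hwell : RungeKutta.WellDefined (n := n) f h A c := fun t x => by
    simpa only [RungeKutta.stageEq_iff] using (hbij t).existsUnique (RungeKutta.kronVec 1 x)
  refine ⟨hwell, ?_, fun G hG => ?_⟩
  · choose G hG hGu using hwell
    exact ⟨G, RungeKutta.isStageSolution_iff.2 hG, fun G' hG' =>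
      funext₂ fun t x => hGu t x _ (RungeKutta.isStageSolution_iff.1 hG' t x)⟩
  have hG' := RungeKutta.isStageSolution_iff.1 hG
  have hexp : RungeKutta.IsExplicitForm f h A b c fun t x =>
      x + h • ((RungeKutta.kronId n b)ᵀ *ᵥ RungeKutta.stackedField f c t (G t x)) := by
    refine fun t x x' => ⟨?_, fun hx' => ⟨G t x, hG' t x, hx'⟩⟩
    rintro ⟨y, hy, rfl⟩
    rw [(hwell t x).unique hy (hG' t x)]
  refine ⟨fun t x hfx hc =>
      (hwell t x).unique (hG' t x) (RungeKutta.stageEq_kronVec_of_eq_zero hfx hc),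
    _, hexp, fun g' hg' => funext₂ fun t x => ?_, fun t x => rfl, hbij, fun t x y hy => ?_⟩
  · exact ((hg' t x _).1 ((hexp t x _).2 rfl)).symm
  · have hy' : RungeKutta.StageEq f h A c t x y := by
      rw [RungeKutta.stageEq_iff, hy]
      exact Equiv.ofBijective_apply_symm_apply _ (hbij t) _
    simp only [(hwell t x).unique (hG' t x) hy']
    exact RungeKutta.update_eq_mean_add (Nat.one_le_iff_ne_zero.1 hs) b hy'
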